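/- Let $C$ be a unital Abelian C$^*$-algebra, and let $X$ and $Y$ be central representable Banach $C$-bimodules: $cx=xc$ for all $c\in C$, $x\in X$, and there are Hilbert spaces $\mathcal H,\mathcal K$ with $*$-representations $\pi:C\to B(\mathcal H)$, $\sigma:C\to B(\mathcal K)$ and a linear isometry $\Phi:X\to B(\mathcal K,\mathcal H)$ such that $\Phi(cx)=\pi(c)\Phi(x)$ and $\Phi(xc)=\Phi(x)\sigma(c)$; similarly for $Y$. Let $X\stackrel{\gamma}{\otimes}_CY$ be the projective tensor product of Banach $C$-modules, that is, the quotient of the Banach space projective tensor product $X\stackrel{\gamma}{\otimes}Y$ by the closed subspace generated by all $xc\otimes y-x\otimes cy$ ($x\in X$, $y\in Y$, $c\in C$), and let $\gamma_C(w)$ be the norm in it of the image of an element $w$ of the algebraic tensor product $X\otimes_CY$. For $A\in\{\mathbb C,C\}$ and $w\in X\otimes_CY$ put $$\gamma_{A}^{\mathrm{bim}}(w)=\inf\Big\{\Big\|\sum_{j=1}^n a_ja_j^*\Big\|^{1/2}\Big\|\sum_{j=1}^n b_j^*b_j\Big\|^{1/2}:\ w=\sum_{j=1}^n a_jx_j\otimes_Cy_jb_j,\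 a_j,b_j\in A,\ \|x_j\|\le1,\ \|y_j\|\le1\Big\},$$ and let ${}_AX\stackrel{\gamma}{\otimes}_CY_A$ be the completion of the quotient of $X\otimes_CY$ by the zero space of the seminorm $\gamma_A^{\mathrm{bim}}$. Then: 1. For each $w\in X\otimes_CY$, $$\gamma_C(w)=\inf\Big\{\Big\|\sum_{j=1}^n c_j\Big\|:\ w=\sum_{j=1}^n c_jx_j\otimes_Cy_j,\ c_j\in C^+,\ x_j\in X,\ y_j\in Y,\ \|x_j\|\le1,\ \|y_j\|\le1\Big\}.$$ 2. Consequently $\gamma_{\mathbb C}^{\mathrm{bim}}=\gamma_{C}^{\mathrm{bim}}=\gamma_C$ on $X\otimes_CY$, and $${}_{\mathbb C}X\stackrel{\gamma}{\otimes}_CY_{\mathbb C}={}_{C}X\stackrel{\gamma}{\otimes}_CY_{C}=X\stackrel{\gamma}{\otimes}_CY,$$ in the sense that these three Banach spaces are isometrically isomorphic by $C$-module isomorphisms that are compatible with the canonical maps from $X\otimes_CY$. -/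

import Mathlib

open scoped TensorProduct
open UniformSpace (Completion)

noncomputable section


universe w u₁ u₂ u₃ u₄ u₅

/-! ### Representable bimodules -/

/-- A normed `A`-`B`-bimodule `X` over unital C*-algebras (`a • x` is the left action and
`MulOpposite.op b • x`, that is `x b`, the right action) is representable if there are Hilbert
spaces `H`, `K` with unital `*`-representations `π` of `A` on `H` and `σ` of `B` on `K`, and an
isometric bimodule homomorphism of `X` into the bounded operators from `K` to `H`. -/
def IsRepresentable (A : Type u₁) (B : Type u₂) (X : Type u₃) [CStarAlgebra A] [CStarAlgebra B]
    [NormedAddCommGroup X] [NormedSpace ℂ X] [Module A X] [Module Bᵐᵒᵖ X] : Prop :=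
  ∃ (H K : Type w) (_ : NormedAddCommGroup H) (_ : InnerProductSpace ℂ H) (_ : CompleteSpace H)
    (_ : NormedAddCommGroup K) (_ : InnerProductSpace ℂ K) (_ : CompleteSpace K)
    (π : A →⋆ₐ[ℂ] (H →L[ℂ] H)) (σ : B →⋆ₐ[ℂ] (K →L[ℂ] K)) (Φ : X →ₗᵢ[ℂ] (K →L[ℂ] H)),
    (∀ (a : A) (x : X), Φ (a • x) = (π a).comp (Φ x)) ∧
    (∀ (b : B) (x : X), Φ (MulOpposite.op b • x) = (Φ x).comp (σ b))

/-! ### The bimodule projective tensor product `_A X ⊗^γ_R Y_D` (with `R` commutative) -/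

section Gamma

variable (A : Type u₁) {R : Type u₂} (D : Type u₃) {X : Type u₄} {Y : Type u₅}
  [CStarAlgebra A] [CommCStarAlgebra R] [CStarAlgebra D]
  [NormedAddCommGroup X] [NormedSpace ℂ X] [NormedAddCommGroup Y] [NormedSpace ℂ Y]
  [Module R X] [Module R Y] [Module A X] [Module Dᵐᵒᵖ Y]

/-- `GammaRep A D w a b x y`: the element `w` is written as `∑ j, a_j x_j ⊗ y_j b_j` with
`x_j`, `y_j` in the closed unit balls. -/
structure GammaRep (w : X ⊗[R] Y) {n : ℕ} (a : Fin n → A) (b : Fin n → D)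
    (x : Fin n → X) (y : Fin n → Y) : Prop where
  norm_left : ∀ j, ‖x j‖ ≤ 1
  norm_right : ∀ j, ‖y j‖ ≤ 1
  eq_sum : w = ∑ j, (a j • x j) ⊗ₜ[R] (MulOpposite.op (b j) • y j)

/-- The projective tensor seminorm `γ` of `_A X ⊗_R Y_D`: the infimum of
`‖∑ a_j a_j*‖^(1/2) ‖∑ b_j* b_j‖^(1/2)` over all representations
`w = ∑ a_j x_j ⊗ y_j b_j` with `‖x_j‖ ≤ 1` and `‖y_j‖ ≤ 1`. -/
def gammaNorm (w : X ⊗[R] Y) : ℝ :=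
  sInf {r : ℝ | ∃ (n : ℕ) (a : Fin n → A) (b : Fin n → D) (x : Fin n → X) (y : Fin n → Y),
    GammaRep A D w a b x y ∧
      r = √‖∑ j, a j * star (a j)‖ * √‖∑ j, star (b j) * b j‖}

/-- The algebraic tensor product `X ⊗_R Y`, to be equipped with the seminorm `gammaNorm A D`. -/
@[nolint unusedArguments]
def GammaTensor (_A : Type u₁) (R : Type u₂) (_D : Type u₃) (X : Type u₄) (Y : Type u₅)
    [CommCStarAlgebra R] [NormedAddCommGroup X] [NormedAddCommGroup Y] [Module R X] [Module R Y] :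
    Type (max u₄ u₅) := X ⊗[R] Y

variable (R X Y)

instance : AddCommGroup (GammaTensor A R D X Y) := inferInstanceAs (AddCommGroup (X ⊗[R] Y))

instance {S : Type*} [Semiring S] [Module S X] [SMulCommClass R S X] :
    Module S (GammaTensor A R D X Y) := inferInstanceAs (Module S (X ⊗[R] Y))

variable {R X Y}
variable [IsScalarTower ℂ R X] [IsScalarTower ℂ R Y] [IsScalarTower ℂ A X]
  [IsScalarTower ℂ Dᵐᵒᵖ Y]

theorem GammaRep.rescale {w : X ⊗[R] Y} {n : ℕ} {a : Fin n → A} {b : Fin n → D}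
    {x : Fin n → X} {y : Fin n → Y} (h : GammaRep A D w a b x y) {l m : ℂ} (hlm : l * m = 1) :
    GammaRep A D w (fun j => l • a j) (fun j => m • b j) x y := by
  refine ⟨h.1, h.2, h.3.trans (Finset.sum_congr rfl fun j _ => ?_)⟩
  rw [MulOpposite.op_smul, smul_assoc, smul_assoc, TensorProduct.smul_tmul (R' := ℂ) l,
    smul_smul, hlm, one_smul]

theorem GammaRep.append {w₁ w₂ : X ⊗[R] Y} {n m : ℕ} {a₁ : Fin n → A} {b₁ : Fin n → D}
    {x₁ : Fin n → X} {y₁ : Fin n → Y} {a₂ : Fin m → A} {b₂ : Fin m → D}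
    {x₂ : Fin m → X} {y₂ : Fin m → Y} (h₁ : GammaRep A D w₁ a₁ b₁ x₁ y₁)
    (h₂ : GammaRep A D w₂ a₂ b₂ x₂ y₂) :
    GammaRep A D (w₁ + w₂) (Fin.append a₁ a₂) (Fin.append b₁ b₂) (Fin.append x₁ x₂)
      (Fin.append y₁ y₂) := by
  refine ⟨fun j => ?_, fun j => ?_, ?_⟩
  · refine Fin.addCases (fun i => ?_) (fun i => ?_) j
    · simpa using h₁.1 i
    · simpa using h₂.1 i
  · refine Fin.addCases (fun i => ?_) (fun i => ?_) j
    · simpa using h₁.2 i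
    · simpa using h₂.2 i
  · rw [Fin.sum_univ_add, h₁.3, h₂.3]
    simp

theorem norm_inv_smul_le_one {Z : Type*} [NormedAddCommGroup Z] [NormedSpace ℂ Z] (z : Z) :
    ‖((‖z‖ : ℂ) + 1)⁻¹ • z‖ ≤ 1 := by
  have : ‖((‖z‖ : ℂ) + 1)‖ = ‖z‖ + 1 := by
    have h : ((‖z‖ : ℂ) + 1) = ((‖z‖ + 1 : ℝ) : ℂ) := by push_cast; rfl
    rw [h, Complex.norm_real, Real.norm_of_nonneg (by positivity)]
  rw [norm_smul, norm_inv, this, inv_mul_le_iff₀ (by positivity)]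
  linarith

theorem exists_gammaRep (w : X ⊗[R] Y) :
    ∃ (n : ℕ) (a : Fin n → A) (b : Fin n → D) (x : Fin n → X) (y : Fin n → Y),
      GammaRep A D w a b x y := by
  induction w using TensorProduct.induction_on with
  | zero => exact ⟨0, Fin.elim0, Fin.elim0, Fin.elim0, Fin.elim0, fun j => j.elim0,
      fun j => j.elim0, by simp⟩
  | tmul x y =>
    have hx : ((‖x‖ : ℂ) + 1) ≠ 0 := by
      have : (0 : ℝ) < ‖x‖ + 1 := by positivity
      exact_mod_cast this.ne'
    have hy : ((‖y‖ : ℂ) + 1) ≠ 0 := by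
      have : (0 : ℝ) < ‖y‖ + 1 := by positivity
      exact_mod_cast this.ne'
    refine ⟨1, fun _ => ((‖x‖ : ℂ) + 1) • 1, fun _ => ((‖y‖ : ℂ) + 1) • 1,
      fun _ => ((‖x‖ : ℂ) + 1)⁻¹ • x, fun _ => ((‖y‖ : ℂ) + 1)⁻¹ • y,
      fun _ => norm_inv_smul_le_one x, fun _ => norm_inv_smul_le_one y, ?_⟩
    simp [MulOpposite.op_smul, smul_assoc, smul_smul, hx, hy]
  | add w₁ w₂ h₁ h₂ =>
    obtain ⟨n, a, b, x, y, h⟩ := h₁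
    obtain ⟨m, a', b', x', y', h'⟩ := h₂
    exact ⟨n + m, _, _, _, _, h.append A D h'⟩

theorem gammaNorm_nonneg (w : X ⊗[R] Y) : 0 ≤ gammaNorm A D w := by
  refine Real.sInf_nonneg ?_
  rintro r ⟨n, a, b, x, y, -, rfl⟩
  positivity

theorem GammaRep.gammaNorm_le {w : X ⊗[R] Y} {n : ℕ} {a : Fin n → A} {b : Fin n → D}
    {x : Fin n → X} {y : Fin n → Y} (h : GammaRep A D w a b x y) {t : ℝ}
    (ha : ‖∑ j, a j * star (a j)‖ ≤ t) (hb : ‖∑ j, star (b j) * b j‖ ≤ t) :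
    gammaNorm A D w ≤ t := by
  have ht : 0 ≤ t := (norm_nonneg _).trans ha
  have hle : gammaNorm A D w ≤ √‖∑ j, a j * star (a j)‖ * √‖∑ j, star (b j) * b j‖ := by
    refine csInf_le ⟨0, ?_⟩ ⟨n, a, b, x, y, h, rfl⟩
    rintro r ⟨n, a, b, x, y, -, rfl⟩
    positivity
  refine hle.trans ?_
  · calc _ ≤ √t * √t := by gcongr
      _ = t := Real.mul_self_sqrt ht

theorem norm_sum_smul_mul_star {n : ℕ} (a : Fin n → A) (l : ℝ) :
    ‖∑ j, ((l : ℂ) • a j) * star ((l : ℂ) • a j)‖ = l ^ 2 * ‖∑ j, a j * star (a j)‖ := by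
  have : ∑ j, ((l : ℂ) • a j) * star ((l : ℂ) • a j)
      = ((l ^ 2 : ℝ) : ℂ) • ∑ j, a j * star (a j) := by
    rw [Finset.smul_sum]
    refine Finset.sum_congr rfl fun j _ => ?_
    rw [star_smul, smul_mul_smul_comm]
    congr 1
    simp [sq]
  rw [this, norm_smul, Complex.norm_real, Real.norm_of_nonneg (sq_nonneg l)]

theorem norm_sum_star_mul_smul {n : ℕ} (a : Fin n → A) (l : ℝ) :
    ‖∑ j, star ((l : ℂ) • a j) * ((l : ℂ) • a j)‖ = l ^ 2 * ‖∑ j, star (a j) * a j‖ := by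
  simpa using norm_sum_smul_mul_star A (fun j => star (a j)) l

theorem exists_gammaRep_of_lt {w : X ⊗[R] Y} {t : ℝ} (ht : gammaNorm A D w < t) :
    ∃ (n : ℕ) (a : Fin n → A) (b : Fin n → D) (x : Fin n → X) (y : Fin n → Y),
      GammaRep A D w a b x y ∧ ‖∑ j, a j * star (a j)‖ ≤ t ∧ ‖∑ j, star (b j) * b j‖ ≤ t := by
  have ht0 : 0 < t := (gammaNorm_nonneg A D w).trans_lt ht
  obtain ⟨n₀, a₀, b₀, x₀, y₀, h₀⟩ := exists_gammaRep A D w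
  obtain ⟨r, ⟨n, a, b, x, y, h, rfl⟩, hr⟩ :=
    exists_lt_of_csInf_lt (by exact ⟨_, n₀, a₀, b₀, x₀, y₀, h₀, rfl⟩) ht
  obtain ⟨p, hp⟩ : ∃ p, p = ‖∑ j, a j * star (a j)‖ := ⟨_, rfl⟩
  obtain ⟨q, hq⟩ : ∃ q, q = ‖∑ j, star (b j) * b j‖ := ⟨_, rfl⟩
  have hp0 : 0 ≤ p := hp ▸ norm_nonneg _
  have hq0 : 0 ≤ q := hq ▸ norm_nonneg _
  rw [← hp, ← hq, ← Real.sqrt_mul hp0, Real.sqrt_lt' ht0] at hr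
  obtain ⟨s, hs, hs1, hs2⟩ : ∃ s : ℝ, 0 < s ∧ s * p ≤ t ∧ s⁻¹ * q ≤ t := by
    rcases hp0.eq_or_lt with h0 | h0
    · refine ⟨q / t + 1, by positivity, by rw [← h0]; simpa using ht0.le, ?_⟩
      rw [inv_mul_le_iff₀ (by positivity), add_mul, div_mul_cancel₀ _ ht0.ne']
      linarith
    · refine ⟨t / p, by positivity, by rw [div_mul_cancel₀ _ h0.ne'], ?_⟩
      rw [inv_mul_le_iff₀ (by positivity), div_mul_eq_mul_div, le_div_iff₀ h0]
      nlinarith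
  have hl : ((√s : ℝ) : ℂ) * ((√s⁻¹ : ℝ) : ℂ) = 1 := by
    rw [← Complex.ofReal_mul, ← Real.sqrt_mul hs.le, mul_inv_cancel₀ hs.ne']
    simp
  refine ⟨n, _, _, x, y, h.rescale A D hl, ?_, ?_⟩
  · rw [norm_sum_smul_mul_star, Real.sq_sqrt hs.le, ← hp]
    exact hs1
  · rw [norm_sum_star_mul_smul, Real.sq_sqrt (inv_nonneg.2 hs.le), ← hq]
    exact hs2

theorem gammaNorm_zero : gammaNorm A D (0 : X ⊗[R] Y) = 0 := by
  refine le_antisymm ?_ (gammaNorm_nonneg A D _)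
  have h : GammaRep A D (0 : X ⊗[R] Y) (n := 0) Fin.elim0 Fin.elim0 Fin.elim0 Fin.elim0 :=
    ⟨fun j => j.elim0, fun j => j.elim0, by simp⟩
  exact h.gammaNorm_le A D (by simp) (by simp)

theorem gammaNorm_add_le (w₁ w₂ : X ⊗[R] Y) :
    gammaNorm A D (w₁ + w₂) ≤ gammaNorm A D w₁ + gammaNorm A D w₂ := by
  refine le_of_forall_pos_le_add fun ε hε => ?_
  obtain ⟨n, a, b, x, y, h, ha, hb⟩ :=
    exists_gammaRep_of_lt A D (show gammaNorm A D w₁ < gammaNorm A D w₁ + ε / 2 by linarith)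
  obtain ⟨m, a', b', x', y', h', ha', hb'⟩ :=
    exists_gammaRep_of_lt A D (show gammaNorm A D w₂ < gammaNorm A D w₂ + ε / 2 by linarith)
  refine (h.append A D h').gammaNorm_le A D ?_ ?_
  · rw [Fin.sum_univ_add]
    simp only [Fin.append_left, Fin.append_right]
    linarith [norm_add_le (∑ j, a j * star (a j)) (∑ j, a' j * star (a' j))]
  · rw [Fin.sum_univ_add]
    simp only [Fin.append_left, Fin.append_right]
    linarith [norm_add_le (∑ j, star (b j) * b j) (∑ j, star (b' j) * b' j)]

/-- Scalars `S` that act contractively on `X`, compatibly with the other actions, act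
contractively on the tensor product (by `s (x ⊗ y) = s x ⊗ y`). -/
theorem gammaNorm_smul_le {S : Type*} [SeminormedRing S] [Module S X] [IsBoundedSMul S X]
    [SMulCommClass R S X] [SMulCommClass S A X] (s : S) (w : X ⊗[R] Y) :
    gammaNorm A D (s • w) ≤ ‖s‖ * gammaNorm A D w := by
  refine le_mul_of_forall_lt₀ fun p hp t ht => ?_
  have hp0 : 0 < p := (norm_nonneg s).trans_lt hp
  obtain ⟨n, a, b, x, y, h, ha, hb⟩ := exists_gammaRep_of_lt A D ht
  have hpp : ((√p : ℝ) : ℂ) * ((√p : ℝ) : ℂ) = (p : ℂ) := by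
    rw [← Complex.ofReal_mul, Real.mul_self_sqrt hp0.le]
  have hpc : (p : ℂ) ≠ 0 := by exact_mod_cast hp0.ne'
  have key : GammaRep A D (s • w) (fun j => ((√p : ℝ) : ℂ) • a j)
      (fun j => ((√p : ℝ) : ℂ) • b j) (fun j => (p : ℂ)⁻¹ • s • x j) y := by
    refine ⟨fun j => ?_, h.2, ?_⟩
    · rw [norm_smul, norm_inv, Complex.norm_real, Real.norm_of_nonneg hp0.le,
        inv_mul_le_iff₀ hp0, mul_one]
      calc ‖s • x j‖ ≤ ‖s‖ * ‖x j‖ := norm_smul_le _ _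
        _ ≤ ‖s‖ * 1 := by gcongr; exact h.1 j
        _ ≤ p := by linarith
    · rw [h.3, Finset.smul_sum]
      refine Finset.sum_congr rfl fun j _ => ?_
      rw [MulOpposite.op_smul, smul_assoc, smul_assoc,
        ← TensorProduct.smul_tmul (R' := ℂ) ((√p : ℝ) : ℂ), smul_comm (a j) ((p : ℂ)⁻¹), smul_smul, smul_smul, hpp, mul_inv_cancel₀ hpc, one_smul,
        TensorProduct.smul_tmul', smul_comm]
  refine key.gammaNorm_le A D ?_ ?_
  · rw [norm_sum_smul_mul_star, Real.sq_sqrt hp0.le]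
    gcongr
  · rw [norm_sum_star_mul_smul, Real.sq_sqrt hp0.le]
    gcongr

variable (R X Y)

/-- `gammaNorm` as a seminorm. -/
def gammaSeminorm : Seminorm ℂ (GammaTensor A R D X Y) :=
  Seminorm.ofSMulLE (E := GammaTensor A R D X Y) (gammaNorm A D (R := R) (X := X) (Y := Y))
    (gammaNorm_zero A D) (gammaNorm_add_le A D) (gammaNorm_smul_le A D)

instance : SeminormedAddCommGroup (GammaTensor A R D X Y) :=
  (gammaSeminorm A R D X Y).toAddGroupSeminorm.toSeminormedAddCommGroup

instance {S : Type*} [SeminormedRing S] [Module S X] [IsBoundedSMul S X]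
    [SMulCommClass R S X] [SMulCommClass S A X] : IsBoundedSMul S (GammaTensor A R D X Y) :=
  IsBoundedSMul.of_norm_smul_le (gammaNorm_smul_le A D (R := R) (X := X) (Y := Y))

instance : NormedSpace ℂ (GammaTensor A R D X Y) where
  norm_smul_le := gammaNorm_smul_le A D (R := R) (X := X) (Y := Y)

/-- The tensor product `_A X ⊗^γ_R Y_D`: the (Hausdorff) completion of `X ⊗_R Y` with respect to
the seminorm `gammaNorm A D`. -/
abbrev GammaProduct : Type (max u₄ u₅) := Completion (GammaTensor A R D X Y)

variable {R X Y}

/-- The canonical map `X ⊗_R Y → _A X ⊗^γ_R Y_D`. -/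
def toGammaProduct (w : X ⊗[R] Y) : GammaProduct A R D X Y :=
  ((show GammaTensor A R D X Y from w) : Completion (GammaTensor A R D X Y))

theorem norm_toGammaProduct (w : X ⊗[R] Y) : ‖toGammaProduct A D w‖ = gammaNorm A D w :=
  Completion.norm_coe (E := GammaTensor A R D X Y) _

end Gamma

/-! ### The Banach space projective tensor product -/

section Proj

variable (X : Type u₄) (Y : Type u₅)
  [NormedAddCommGroup X] [NormedSpace ℂ X] [NormedAddCommGroup Y] [NormedSpace ℂ Y]

variable {X Y} in
/-- The projective tensor norm on `X ⊗ Y`: the infimum of `∑ ‖x_j‖ ‖y_j‖` over all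
representations `w = ∑ x_j ⊗ y_j`. -/
def projNorm (w : X ⊗[ℂ] Y) : ℝ :=
  sInf {r : ℝ | ∃ (n : ℕ) (x : Fin n → X) (y : Fin n → Y),
    w = ∑ j, x j ⊗ₜ[ℂ] y j ∧ r = ∑ j, ‖x j‖ * ‖y j‖}

/-- The algebraic tensor product `X ⊗ Y` of normed spaces, to be equipped with `projNorm`. -/
def ProjTensor : Type (max u₄ u₅) := X ⊗[ℂ] Y

instance : AddCommGroup (ProjTensor X Y) := inferInstanceAs (AddCommGroup (X ⊗[ℂ] Y))

instance {S : Type*} [Semiring S] [Module S X] [SMulCommClass ℂ S X] :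
    Module S (ProjTensor X Y) := inferInstanceAs (Module S (X ⊗[ℂ] Y))

instance {S T : Type*} [Semiring S] [Module S X] [SMulCommClass ℂ S X] [Semiring T] [Module T X]
    [SMulCommClass ℂ T X] [SMul S T] [IsScalarTower S T X] :
    IsScalarTower S T (ProjTensor X Y) := inferInstanceAs (IsScalarTower S T (X ⊗[ℂ] Y))

variable {X Y}

theorem projNorm_le {w : X ⊗[ℂ] Y} {n : ℕ} {x : Fin n → X} {y : Fin n → Y}
    (h : w = ∑ j, x j ⊗ₜ[ℂ] y j) : projNorm w ≤ ∑ j, ‖x j‖ * ‖y j‖ := by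
  refine csInf_le ⟨0, ?_⟩ ⟨n, x, y, h, rfl⟩
  rintro r ⟨n, x, y, -, rfl⟩
  positivity

theorem projNorm_nonneg (w : X ⊗[ℂ] Y) : 0 ≤ projNorm w := by
  refine Real.sInf_nonneg ?_
  rintro r ⟨n, x, y, -, rfl⟩
  positivity

theorem exists_rep_of_projNorm_lt {w : X ⊗[ℂ] Y} {t : ℝ} (ht : projNorm w < t) :
    ∃ (n : ℕ) (x : Fin n → X) (y : Fin n → Y),
      w = ∑ j, x j ⊗ₜ[ℂ] y j ∧ ∑ j, ‖x j‖ * ‖y j‖ < t := by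
  have hne : ∃ (n : ℕ) (x : Fin n → X) (y : Fin n → Y), w = ∑ j, x j ⊗ₜ[ℂ] y j := by
    clear ht
    induction w using TensorProduct.induction_on with
    | zero => exact ⟨0, Fin.elim0, Fin.elim0, by simp⟩
    | tmul x y => exact ⟨1, fun _ => x, fun _ => y, by simp⟩
    | add w₁ w₂ h₁ h₂ =>
      obtain ⟨n, x, y, h⟩ := h₁
      obtain ⟨m, x', y', h'⟩ := h₂
      exact ⟨n + m, Fin.append x x', Fin.append y y', by rw [Fin.sum_univ_add, h, h']; simp⟩
  obtain ⟨n₀, x₀, y₀, h₀⟩ := hne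
  obtain ⟨r, ⟨n, x, y, h, rfl⟩, hr⟩ := 
    exists_lt_of_csInf_lt (by exact ⟨_, n₀, x₀, y₀, h₀, rfl⟩) ht
  exact ⟨n, x, y, h, hr⟩

theorem projNorm_zero : projNorm (0 : X ⊗[ℂ] Y) = 0 :=
  le_antisymm ((projNorm_le (n := 0) (x := Fin.elim0) (y := Fin.elim0) (by simp)).trans (by simp))
    (projNorm_nonneg _)

theorem projNorm_add_le (w₁ w₂ : X ⊗[ℂ] Y) :
    projNorm (w₁ + w₂) ≤ projNorm w₁ + projNorm w₂ := by
  refine le_of_forall_pos_le_add fun ε hε => ?_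
  obtain ⟨n, x, y, h, hr⟩ :=
    exists_rep_of_projNorm_lt (show projNorm w₁ < projNorm w₁ + ε / 2 by linarith)
  obtain ⟨m, x', y', h', hr'⟩ :=
    exists_rep_of_projNorm_lt (show projNorm w₂ < projNorm w₂ + ε / 2 by linarith)
  refine (projNorm_le (x := Fin.append x x') (y := Fin.append y y') ?_).trans ?_
  · rw [Fin.sum_univ_add, h, h']
    simp
  · rw [Fin.sum_univ_add]
    simp only [Fin.append_left, Fin.append_right]
    linarith

theorem projNorm_smul_le {S : Type*} [SeminormedRing S] [Module S X] [IsBoundedSMul S X]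
    [SMulCommClass ℂ S X] (s : S) (w : X ⊗[ℂ] Y) : projNorm (s • w) ≤ ‖s‖ * projNorm w := by
  refine le_mul_of_forall_lt₀ fun p hp t ht => ?_
  have hp0 : 0 < p := (norm_nonneg s).trans_lt hp
  obtain ⟨n, x, y, h, hr⟩ := exists_rep_of_projNorm_lt ht
  refine (projNorm_le (x := fun j => s • x j) (y := y) ?_).trans ?_
  · rw [h, Finset.smul_sum]
    rfl
  · calc ∑ j, ‖s • x j‖ * ‖y j‖ ≤ ∑ j, p * (‖x j‖ * ‖y j‖) := by
          refine Finset.sum_le_sum fun j _ => ?_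
          rw [← mul_assoc]
          gcongr
          exact (norm_smul_le _ _).trans (by gcongr)
      _ = p * ∑ j, ‖x j‖ * ‖y j‖ := by rw [Finset.mul_sum]
      _ ≤ p * t := by gcongr

variable (X Y)

/-- `projNorm` as a seminorm. -/
def projSeminorm : Seminorm ℂ (ProjTensor X Y) :=
  Seminorm.ofSMulLE (E := ProjTensor X Y) (projNorm (X := X) (Y := Y)) projNorm_zero
    projNorm_add_le projNorm_smul_le

instance : SeminormedAddCommGroup (ProjTensor X Y) :=
  (projSeminorm X Y).toAddGroupSeminorm.toSeminormedAddCommGroup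

instance {S : Type*} [SeminormedRing S] [Module S X] [IsBoundedSMul S X]
    [SMulCommClass ℂ S X] : IsBoundedSMul S (ProjTensor X Y) :=
  IsBoundedSMul.of_norm_smul_le (projNorm_smul_le (X := X) (Y := Y))

instance : NormedSpace ℂ (ProjTensor X Y) where
  norm_smul_le := projNorm_smul_le (X := X) (Y := Y)

/-- The Banach space projective tensor product `X ⊗^γ Y`. -/
abbrev ProjProduct : Type (max u₄ u₅) := Completion (ProjTensor X Y)

variable {X Y}

/-- The canonical map `X ⊗ Y → X ⊗^γ Y`. -/
def toProjProduct (w : X ⊗[ℂ] Y) : ProjProduct X Y :=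
  ((show ProjTensor X Y from w) : Completion (ProjTensor X Y))

theorem toProjProduct_add (w₁ w₂ : X ⊗[ℂ] Y) :
    toProjProduct (w₁ + w₂) = toProjProduct w₁ + toProjProduct w₂ :=
  Completion.coe_add (α := ProjTensor X Y) _ _

theorem toProjProduct_sub (w₁ w₂ : X ⊗[ℂ] Y) :
    toProjProduct (w₁ - w₂) = toProjProduct w₁ - toProjProduct w₂ :=
  Completion.coe_sub (α := ProjTensor X Y) _ _

theorem toProjProduct_smul {S : Type*} [SeminormedRing S] [Module S X] [IsBoundedSMul S X]
    [SMulCommClass ℂ S X] (s : S) (w : X ⊗[ℂ] Y) :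
    toProjProduct (s • w) = s • toProjProduct w :=
  Completion.coe_smul s (show ProjTensor X Y from w)

end Proj

/-! ### The projective tensor product of Banach `C`-modules -/

section Balanced

variable (C : Type u₁) (X : Type u₄) (Y : Type u₅) [CommCStarAlgebra C]
  [NormedAddCommGroup X] [NormedSpace ℂ X] [Module C X] [Module Cᵐᵒᵖ X] [IsScalarTower ℂ C X]
  [IsBoundedSMul C X] [NormedAddCommGroup Y] [NormedSpace ℂ Y] [Module C Y] [IsScalarTower ℂ C Y]

/-- The elements `x c ⊗ y - x ⊗ c y` of `X ⊗^γ Y`. -/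
def balancedRelations : Set (ProjProduct X Y) :=
  {z | ∃ (x : X) (c : C) (y : Y),
    z = toProjProduct ((MulOpposite.op c • x) ⊗ₜ[ℂ] y - x ⊗ₜ[ℂ] (c • y))}

/-- The closed subspace of `X ⊗^γ Y` generated by all `x c ⊗ y - x ⊗ c y`, as a `C`-submodule
(see `coe_balancedSubmodule`). -/
def balancedSubmodule : Submodule C (ProjProduct X Y) :=
  (Submodule.span C (balancedRelations C X Y)).topologicalClosure

instance : IsClosed (balancedSubmodule C X Y : Set (ProjProduct X Y)) :=
  Submodule.isClosed_topologicalClosure _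

/-- The quotient of the Banach space projective tensor product `X ⊗^γ Y` by the closed subspace
generated by all `x c ⊗ y - x ⊗ c y`, with the quotient norm. -/
abbrev BanachModuleTensor : Type (max u₄ u₅) := ProjProduct X Y ⧸ balancedSubmodule C X Y

variable [IsCentralScalar C X]

/-- The `C`-submodule `balancedSubmodule` is the closed complex linear span of the
elements `x c ⊗ y - x ⊗ c y`. -/
theorem coe_balancedSubmodule :
    (balancedSubmodule C X Y : Set (ProjProduct X Y)) =
      closure (Submodule.span ℂ (balancedRelations C X Y) : Set (ProjProduct X Y)) := by
  have : (Submodule.span C (balancedRelations C X Y) : Set (ProjProduct X Y)) =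
      (Submodule.span ℂ (balancedRelations C X Y) : Set (ProjProduct X Y)) := by
    refine Set.Subset.antisymm ?_ (Submodule.span_subset_span ℂ C _)
    intro z hz
    induction hz using Submodule.span_induction with
    | mem z hz => exact Submodule.subset_span hz
    | zero => exact zero_mem _
    | add z z' _ _ h h' => exact add_mem h h'
    | smul c z hz h =>
      clear hz
      induction h using Submodule.span_induction with
      | mem z hz =>
        obtain ⟨x, d, y, rfl⟩ := hz
        refine Submodule.subset_span ⟨c • x, d, y, ?_⟩
        rw [← toProjProduct_smul, smul_sub, TensorProduct.smul_tmul', TensorProduct.smul_tmul',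
          op_smul_eq_smul, op_smul_eq_smul, smul_comm]
      | zero => simp
      | add z z' _ _ h h' => rw [smul_add]; exact add_mem h h'
      | smul l z _ h => rw [smul_comm]; exact Submodule.smul_mem _ _ h
  rw [← this]
  rfl

variable {C X Y}

/-- The canonical map `X ⊗_C Y → X ⊗^γ_C Y`, `x ⊗ y ↦ x ⊗ y`. -/
def toBanachModuleTensor : X ⊗[C] Y →+ BanachModuleTensor C X Y :=
  TensorProduct.liftAddHom
    (AddMonoidHom.mk'
      (fun x => AddMonoidHom.mk'
        (fun y => (balancedSubmodule C X Y).mkQ (toProjProduct (x ⊗ₜ[ℂ] y)))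
        (fun y y' => by rw [TensorProduct.tmul_add, toProjProduct_add, map_add]))
      (fun x x' => by
        ext y
        simp only [AddMonoidHom.mk'_apply, AddMonoidHom.add_apply]
        rw [TensorProduct.add_tmul, toProjProduct_add, map_add]))
    (fun c x y => by
      simp only [AddMonoidHom.mk'_apply]
      rw [← sub_eq_zero, ← map_sub, ← toProjProduct_sub, Submodule.mkQ_apply,
        Submodule.Quotient.mk_eq_zero]
      refine Submodule.le_topologicalClosure _ (Submodule.subset_span ⟨x, c, y, ?_⟩)
      rw [op_smul_eq_smul])

theorem toBanachModuleTensor_tmul (x : X) (y : Y) :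
    toBanachModuleTensor (x ⊗ₜ[C] y) =
      (balancedSubmodule C X Y).mkQ (toProjProduct (x ⊗ₜ[ℂ] y)) := rfl

end Balanced

end

/-!
If `a` and `b` are orthogonal positive contractions of `C`, then `‖a x + b x'‖ ≤ max ‖x‖ ‖x'‖` in a
representable `C`-module. This passes to the projective tensor product over `C`, since
`(√a x + √b x') ⊗ (√a y + √b y') = a (x ⊗ y) + b (x' ⊗ y')` when `a b = 0`. Cutting a contraction
`f` into layers, most of which take only the values `0` and `1` at a given point, and averaging
upgrades the orthogonal case to `‖f u + (1 - f) v‖ ≤ max ‖u‖ ‖v‖`, that is, to convexity of the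
unit ball with coefficients in `C`. Hence `‖∑ z_j u_j‖ ≤ ‖∑ c_j‖` whenever `|z_j| ≤ c_j` and
`‖u_j‖ ≤ 1`. For `z_j = c_j` this is the lower bound in the formula for `γ_C`, and for
`z_j = a_j b_j` and `c_j = (|a_j|² + |b_j|²) / 2` it gives `γ_C ≤ γ_C^bim`; the other inequalities
hold because scalar multiples of elementary tensors are allowed in all the infima.
-/

open scoped Topology

section OrthogonalMaxNorm

/-- Gluing two vectors of `E` along orthogonal contractions `0 ≤ a, b ≤ 1` of `C` does not increase
the norm. This is `C`-convexity of the unit ball of `E` (see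
`HasOrthogonalMaxNorm.norm_smul_add_one_sub_smul_le`), restricted to the case that is inherited by
tensor products. -/
def HasOrthogonalMaxNorm (C E : Type*) [Ring C] [PartialOrder C] [SeminormedAddCommGroup E]
    [Module C E] : Prop :=
  ∀ ⦃a b : C⦄, a ∈ Set.Icc 0 1 → b ∈ Set.Icc 0 1 → a * b = 0 →
    ∀ x y : E, ‖a • x + b • y‖ ≤ max ‖x‖ ‖y‖

variable {C E : Type*}

theorem HasOrthogonalMaxNorm.norm_smul_le [Ring C] [PartialOrder C] [ZeroLEOneClass C]
    [SeminormedAddCommGroup E] [Module C E] (hE : HasOrthogonalMaxNorm C E) {a : C}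
    (ha : a ∈ Set.Icc 0 1) (x : E) : ‖a • x‖ ≤ ‖x‖ := by
  simpa using hE ha ⟨le_rfl, zero_le_one⟩ (mul_zero a) x 0

/-- The part of `s` between `i` and `i + 1`, for the layer-cake decomposition of `s`. -/
def layer (i : ℕ) (s : ℝ) : ℝ := min s (i + 1) - min s i

@[fun_prop]
theorem continuous_layer (i : ℕ) : Continuous (layer i) := by
  unfold layer
  fun_prop

theorem layer_mem_Icc (i : ℕ) (s : ℝ) : layer i s ∈ Set.Icc 0 1 := by
  unfold layer
  constructor <;> grind

theorem layer_succ_mul_one_sub_layer (i : ℕ) (s : ℝ) : layer (i + 1) s * (1 - layer i s) = 0 := by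
  unfold layer
  push_cast
  rcases le_total s (i + 1) with h | h
  · rw [min_eq_left h, min_eq_left (by linarith), sub_self, zero_mul]
  · rw [min_eq_right h, min_eq_right (by linarith : (i : ℝ) ≤ s), add_sub_cancel_left, sub_self,
      mul_zero]

theorem sum_range_layer {N : ℕ} {s : ℝ} (hs : s ∈ Set.Icc 0 (N : ℝ)) :
    ∑ i ∈ Finset.range N, layer i s = s := by
  have h := Finset.sum_range_sub (fun i : ℕ => min s i) N
  simpa [layer, hs.1, hs.2] using h

theorem exists_layers {A : Type*} [CStarAlgebra A] [PartialOrder A] [StarOrderedRing A] {f : A}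
    (hf : f ∈ Set.Icc 0 1) (N : ℕ) :
    ∃ e : ℕ → A, (∀ i, e i ∈ Set.Icc 0 1) ∧ (∀ i, e (i + 1) * (1 - e i) = 0) ∧
      ∑ i ∈ Finset.range N, e i = N • f := by
  have hsa : IsSelfAdjoint f := .of_nonneg hf.1
  have hspec : spectrum ℝ f ⊆ Set.Icc 0 1 := fun s hs =>
    ⟨spectrum_nonneg_of_nonneg hf.1 hs,
      (CFC.le_one_iff (R := ℝ) f hsa).1 hf.2 s hs⟩
  refine ⟨fun i => cfc (fun s : ℝ => layer i (N * s)) f, fun i => ⟨?_, ?_⟩, fun i => ?_, ?_⟩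
  · exact cfc_nonneg fun s _ => (layer_mem_Icc i _).1
  · exact cfc_le_one _ _ fun s _ => (layer_mem_Icc i _).2
  · have hsub : 1 - cfc (fun s : ℝ => layer i (N * s)) f =
        cfc (fun s : ℝ => 1 - layer i (N * s)) f := by
      rw [cfc_sub _ _ f continuousOn_const (by fun_prop), cfc_const_one ℝ f]
    rw [hsub, ← cfc_mul _ _ f (by fun_prop) (by fun_prop)]
    simp only [layer_succ_mul_one_sub_layer, cfc_const_zero]
  · rw [← cfc_sum _ _ _ fun i _ => by fun_prop]
    calc cfc (∑ i ∈ Finset.range N, fun s : ℝ => layer i (N * s)) f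
        = cfc (fun s : ℝ => N * s) f := cfc_congr fun s hs => by
          have := hspec hs
          simp only [Finset.sum_apply]
          exact sum_range_layer ⟨by have := this.1; positivity,
            mul_le_of_le_one_right N.cast_nonneg this.2⟩
      _ = N • f := by rw [cfc_const_mul_id (N : ℝ) f, Nat.cast_smul_eq_nsmul]

/-- With `e i` the layers of `(n + 1) f`, the glued vectors `e (i + 1) u + (1 - e i) v` have norm
at most `max ‖u‖ ‖v‖`; they add up to `(n + 1) (f u + (1 - f) v)` except for two terms. -/
theorem HasOrthogonalMaxNorm.norm_smul_add_one_sub_smul_le [CStarAlgebra C] [PartialOrder C]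
    [StarOrderedRing C] [SeminormedAddCommGroup E] [NormedSpace ℝ E] [Module C E]
    (hE : HasOrthogonalMaxNorm C E) {f : C} (hf : f ∈ Set.Icc 0 1) (u v : E) :
    ‖f • u + (1 - f) • v‖ ≤ max ‖u‖ ‖v‖ := by
  set t := max ‖u‖ ‖v‖
  have hIcc {e : C} (he : e ∈ Set.Icc 0 1) : 1 - e ∈ Set.Icc 0 1 :=
    ⟨sub_nonneg.2 he.2, sub_le_self _ he.1⟩
  have hbound (n : ℕ) : (n + 1 : ℝ) * ‖f • u + (1 - f) • v‖ ≤ (n + 2 : ℝ) * t := by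
    obtain ⟨e, he, hmul, hsum⟩ := exists_layers hf (n + 1)
    have hglue : (n + 1) • (f • u + (1 - f) • v) =
        e 0 • u + ∑ i ∈ Finset.range n, (e (i + 1) • u + (1 - e i) • v) + (1 - e n) • v := by
      have hu : (n + 1) • f • u = ∑ i ∈ Finset.range n, e (i + 1) • u + e 0 • u := by
        rw [← smul_assoc, ← hsum, Finset.sum_smul, Finset.sum_range_succ']
      have hv : (n + 1) • (1 - f) • v =
          ∑ i ∈ Finset.range n, (1 - e i) • v + (1 - e n) • v := by
        rw [← Finset.sum_range_succ fun i => (1 - e i) • v, ← Finset.sum_smul,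
          Finset.sum_sub_distrib, hsum, ← smul_assoc, smul_sub]
        simp
      rw [smul_add, hu, hv, Finset.sum_add_distrib]
      abel
    calc (n + 1 : ℝ) * ‖f • u + (1 - f) • v‖ = ‖(n + 1) • (f • u + (1 - f) • v)‖ := by
          rw [← Nat.cast_smul_eq_nsmul ℝ, norm_smul, Real.norm_natCast, Nat.cast_succ]
      _ ≤ t + ∑ _i ∈ Finset.range n, t + t := by
          rw [hglue]
          refine norm_add₃_le.trans (add_le_add_three ?_ (norm_sum_le_of_le _ fun i _ => ?_) ?_)
          · exact (hE.norm_smul_le (he 0) u).trans (le_max_left _ _)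
          · exact hE (he _) (hIcc (he i)) (hmul i) u v
          · exact (hE.norm_smul_le (hIcc (he n)) v).trans (le_max_right _ _)
      _ = (n + 2 : ℝ) * t := by simp; ring
  refine le_of_forall_pos_le_add fun ε hε => ?_
  obtain ⟨n, hn⟩ := exists_nat_gt (t / ε)
  rw [div_lt_iff₀ hε] at hn
  have := hbound n
  nlinarith

theorem norm_one_le_one (A : Type*) [CStarAlgebra A] : ‖(1 : A)‖ ≤ 1 := by
  cases subsingleton_or_nontrivial A
  · simp [Subsingleton.elim (1 : A) 0]
  · exact CStarRing.norm_one.le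

theorem exists_norm_le_one_mul_eq_of_star_mul_self_le {A : Type*} [CStarAlgebra A]
    [PartialOrder A] [StarOrderedRing A] {c z : A} (hc : IsStrictlyPositive c)
    (hz : star z * z ≤ c * c) : ∃ k, ‖k‖ ≤ 1 ∧ k * c = z := by
  obtain ⟨u, rfl⟩ := hc.isUnit
  have hinv : star (↑u⁻¹ : A) = ↑u⁻¹ := by
    rw [← Units.coe_star, star_inv]
    congr 1
    exact inv_inj.2 (Units.ext hc.isSelfAdjoint.star_eq)
  have hk : star (z * ↑u⁻¹) * (z * ↑u⁻¹) ≤ 1 :=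
    calc star (z * ↑u⁻¹) * (z * ↑u⁻¹) = star (↑u⁻¹ : A) * (star z * z) * ↑u⁻¹ := by
          simp only [star_mul, mul_assoc]
      _ ≤ star (↑u⁻¹ : A) * (u * u) * ↑u⁻¹ := star_left_conjugate_le_conjugate hz _
      _ = 1 := by simp [hinv]
  refine ⟨z * ↑u⁻¹, ?_, by simp⟩
  rw [← CStarAlgebra.norm_le_one_iff_of_nonneg _ (star_mul_self_nonneg _),
    CStarRing.norm_star_mul_self, ← sq] at hk
  exact (sq_le_one_iff₀ (norm_nonneg _)).1 hk

section CommCStarAlgebra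

variable [CommCStarAlgebra C] [PartialOrder C] [StarOrderedRing C]

theorem exists_mem_Icc_add_mul_eq {s c : C} (hs : 0 ≤ s) (hc : 0 ≤ c)
    (hsc : IsStrictlyPositive (s + c)) : ∃ f ∈ Set.Icc (0 : C) 1, (s + c) * f = s := by
  have hinv : 0 ≤ Ring.inverse (s + c) := hsc.ringInverse.nonneg
  have hmul : (s + c) * Ring.inverse (s + c) = 1 := Ring.mul_inverse_cancel _ hsc.isUnit
  refine ⟨s * Ring.inverse (s + c), ⟨(Commute.all _ _).mul_nonneg hs hinv, ?_⟩, ?_⟩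
  · rw [← hmul, add_mul]
    exact le_add_of_nonneg_right ((Commute.all _ _).mul_nonneg hc hinv)
  · rw [mul_left_comm, hmul, mul_one]

theorem star_mul_mul_le_sq (a b : C) :
    star (a * b) * (a * b) ≤ ((2⁻¹ : ℝ) • (a * star a + star b * b)) ^ 2 := by
  set p := a * star a
  set q := star b * b
  have hpq : star (a * b) * (a * b) = p * q := by simp only [p, q, star_mul]; ring
  have hsa : IsSelfAdjoint ((2⁻¹ : ℝ) • (p - q)) :=
    (IsSelfAdjoint.all (2⁻¹ : ℝ)).smul ((IsSelfAdjoint.mul_star_self a).sub (.star_mul_self b))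
  have hdiff : ((2⁻¹ : ℝ) • (p + q)) ^ 2 - p * q = ((2⁻¹ : ℝ) • (p - q)) ^ 2 := by
    rw [smul_pow, smul_pow, show (p + q) ^ 2 = (p - q) ^ 2 + (4 : ℝ) • (p * q) by
      rw [ofNat_smul_eq_nsmul]; ring]
    module
  rw [hpq, ← sub_nonneg, hdiff, sq]
  exact hsa.mul_self_nonneg

variable [SeminormedAddCommGroup E] [NormedSpace ℝ E] [Module C E]

theorem HasOrthogonalMaxNorm.exists_sum_smul_eq (hE : HasOrthogonalMaxNorm C E) {ι : Type*}
    {d : C} (hd : IsStrictlyPositive d) {c : ι → C} (hc : ∀ i, 0 ≤ c i) {u : ι → E}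
    (hu : ∀ i, ‖u i‖ ≤ 1) (s : Finset ι) :
    ∃ v : E, ‖v‖ ≤ 1 ∧ ∑ i ∈ s, c i • u i = (d + ∑ i ∈ s, c i) • v := by
  classical
  induction s using Finset.induction_on with
  | empty => exact ⟨0, by simp, by simp⟩
  | insert k s hk ih =>
    obtain ⟨v, hv, hsum⟩ := ih
    have hS : IsStrictlyPositive (d + ∑ i ∈ s, c i) :=
      hd.add_nonneg (Finset.sum_nonneg fun i _ => hc i)
    obtain ⟨f, hf, hmul⟩ := exists_mem_Icc_add_mul_eq hS.nonneg (hc k) (hS.add_nonneg (hc k))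
    refine ⟨f • v + (1 - f) • u k,
      (hE.norm_smul_add_one_sub_smul_le hf v (u k)).trans (max_le hv (hu k)), ?_⟩
    rw [Finset.sum_insert hk, Finset.sum_insert hk, hsum, add_left_comm, add_comm (c k), smul_add,
      smul_smul, smul_smul, mul_sub, hmul, mul_one, add_sub_cancel_left, add_comm]

variable [IsBoundedSMul C E]

theorem HasOrthogonalMaxNorm.norm_sum_smul_le (hE : HasOrthogonalMaxNorm C E) {ι : Type*}
    [Fintype ι] {c : ι → C} (hc : ∀ i, 0 ≤ c i) {u : ι → E} (hu : ∀ i, ‖u i‖ ≤ 1) :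
    ‖∑ i, c i • u i‖ ≤ ‖∑ i, c i‖ := by
  have hle : ∀ᶠ δ : ℝ in 𝓝[>] 0, ‖∑ i, c i • u i‖ ≤ ‖algebraMap ℝ C δ + ∑ i, c i‖ := by
    filter_upwards [self_mem_nhdsWithin] with δ (hδ : 0 < δ)
    obtain ⟨v, hv, hsum⟩ :=
      hE.exists_sum_smul_eq (isStrictlyPositive_algebraMap hδ) hc hu Finset.univ
    rw [hsum]
    exact (_root_.norm_smul_le _ v).trans (mul_le_of_le_one_right (norm_nonneg _) hv)
  refine ge_of_tendsto (Continuous.tendsto' ?_ 0 _ (by simp) |>.mono_left nhdsWithin_le_nhds) hle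
  fun_prop

/-- If `c i` is strictly positive, then `z i = k i * c i` with a contraction `k i`, which can be
moved to `u i`. -/
theorem HasOrthogonalMaxNorm.norm_sum_smul_le_of_star_mul_self_le (hE : HasOrthogonalMaxNorm C E)
    {ι : Type*} [Fintype ι] {c z : ι → C} (hc : ∀ i, 0 ≤ c i)
    (hz : ∀ i, star (z i) * z i ≤ c i ^ 2) {u : ι → E} (hu : ∀ i, ‖u i‖ ≤ 1) :
    ‖∑ i, z i • u i‖ ≤ ‖∑ i, c i‖ := by
  have hle : ∀ᶠ δ : ℝ in 𝓝[>] 0, ‖∑ i, z i • u i‖ ≤ ‖∑ i, (c i + algebraMap ℝ C δ)‖ := by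
    filter_upwards [self_mem_nhdsWithin] with δ (hδ : 0 < δ)
    have hpos (i : ι) : IsStrictlyPositive (c i + algebraMap ℝ C δ) :=
      (isStrictlyPositive_algebraMap hδ).nonneg_add (hc i)
    have hz' (i : ι) : star (z i) * z i ≤ (c i + algebraMap ℝ C δ) * (c i + algebraMap ℝ C δ) := by
      refine (hz i).trans ?_
      rw [← sub_nonneg, show (c i + algebraMap ℝ C δ) * (c i + algebraMap ℝ C δ) - c i ^ 2 =
        algebraMap ℝ C δ * (c i + (c i + algebraMap ℝ C δ)) by ring]
      exact (Commute.all _ _).mul_nonneg (isStrictlyPositive_algebraMap hδ).nonneg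
        (add_nonneg (hc i) (hpos i).nonneg)
    choose k hk hkz using fun i => exists_norm_le_one_mul_eq_of_star_mul_self_le (hpos i) (hz' i)
    have hku (i : ι) : ‖k i • u i‖ ≤ 1 :=
      (_root_.norm_smul_le _ _).trans (mul_le_one₀ (hk i) (norm_nonneg _) (hu i))
    simp only [← hkz, mul_comm (k _), mul_smul]
    exact hE.norm_sum_smul_le (fun i => (hpos i).nonneg) hku
  refine ge_of_tendsto (Continuous.tendsto' ?_ 0 _ (by simp) |>.mono_left nhdsWithin_le_nhds) hle
  fun_prop

end CommCStarAlgebra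

end OrthogonalMaxNorm

section Representable

theorem norm_add_eq_max_of_adjoint_comp_eq_zero {H K : Type*}
    [NormedAddCommGroup H] [InnerProductSpace ℂ H] [CompleteSpace H]
    [NormedAddCommGroup K] [InnerProductSpace ℂ K] [CompleteSpace K] {S T : K →L[ℂ] H}
    (hrange : S.adjoint ∘L T = 0) (hsource : S ∘L T.adjoint = 0) :
    ‖S + T‖ = max ‖S‖ ‖T‖ := by
  have hrange' : T.adjoint ∘L S = 0 := by
    simpa [ContinuousLinearMap.adjoint_comp] using congrArg ContinuousLinearMap.adjoint hrange
  have hsq : (S + T).adjoint ∘L (S + T) = S.adjoint ∘L S + T.adjoint ∘L T := by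
    simp [ContinuousLinearMap.add_comp, ContinuousLinearMap.comp_add, hrange, hrange']
  have hsa (U : K →L[ℂ] H) : IsSelfAdjoint (U.adjoint ∘L U) := by
    simp [ContinuousLinearMap.isSelfAdjoint_iff', ContinuousLinearMap.adjoint_comp]
  have hmul : (S.adjoint ∘L S) * (T.adjoint ∘L T) = 0 :=
    calc (S.adjoint ∘L S) * (T.adjoint ∘L T) = S.adjoint ∘L (S ∘L T.adjoint) ∘L T := rfl
      _ = 0 := by simp [hsource]
  have hmax := (hsa S).norm_add_eq_max (hsa T) hmul
  simp only [← hsq, ContinuousLinearMap.norm_adjoint_comp_self, ← sq] at hmax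
  rw [← pow_left_inj₀ (norm_nonneg _) (le_max_of_le_left (norm_nonneg S)) two_ne_zero, hmax]
  exact ((pow_left_monotoneOn (n := 2)).map_max (norm_nonneg S) (norm_nonneg T)).symm

theorem IsRepresentable.hasOrthogonalMaxNorm {C X : Type*} [CStarAlgebra C] [PartialOrder C]
    [StarOrderedRing C] [NormedAddCommGroup X] [NormedSpace ℂ X] [Module C X] [Module Cᵐᵒᵖ X]
    [IsCentralScalar C X] [IsBoundedSMul C X] (hX : IsRepresentable C C X) :
    HasOrthogonalMaxNorm C X := by
  intro a b ha hb hab x x'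
  obtain ⟨H, K, _, _, _, _, _, _, π, σ, Φ, hπ, hσ⟩ := hX
  have hσ' (c : C) (z : X) : Φ (c • z) = Φ z ∘L σ c := by rw [← hσ, op_smul_eq_smul]
  have hrange : (Φ (a • x)).adjoint ∘L Φ (b • x') = 0 := by
    calc (Φ (a • x)).adjoint ∘L Φ (b • x')
        = (Φ x).adjoint ∘L (star (π a) * π b) ∘L Φ x' := by
          rw [hπ, hπ, ContinuousLinearMap.adjoint_comp]; rfl
      _ = 0 := by
          rw [← map_star, (IsSelfAdjoint.of_nonneg ha.1).star_eq, ← map_mul, hab]; simp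
  have hsource : Φ (a • x) ∘L (Φ (b • x')).adjoint = 0 := by
    calc Φ (a • x) ∘L (Φ (b • x')).adjoint
        = Φ x ∘L (σ a * star (σ b)) ∘L (Φ x').adjoint := by
          rw [hσ', hσ', ContinuousLinearMap.adjoint_comp]; rfl
      _ = 0 := by
          rw [← map_star, (IsSelfAdjoint.of_nonneg hb.1).star_eq, ← map_mul, hab]; simp
  have hcontr {c : C} (hc : c ∈ Set.Icc 0 1) (z : X) : ‖c • z‖ ≤ ‖z‖ :=
    (norm_smul_le c z).trans (mul_le_of_le_one_left (norm_nonneg z)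
      ((CStarAlgebra.norm_le_one_iff_of_nonneg c hc.1).2 hc.2))
  calc ‖a • x + b • x'‖ = ‖Φ (a • x) + Φ (b • x')‖ := by rw [← map_add, Φ.norm_map]
    _ = max ‖a • x‖ ‖b • x'‖ := by
      rw [norm_add_eq_max_of_adjoint_comp_eq_zero hrange hsource, Φ.norm_map, Φ.norm_map]
    _ ≤ max ‖x‖ ‖x'‖ := max_le_max (hcontr ha x) (hcontr hb x')

end Representable

section BanachModuleTensor

theorem exists_smul_norm_le_one_eq {E : Type*} [NormedAddCommGroup E] [NormedSpace ℂ E] (x : E) :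
    ∃ x' : E, ‖x'‖ ≤ 1 ∧ x = (‖x‖ : ℂ) • x' := by
  refine ⟨(‖x‖ : ℂ)⁻¹ • x, ?_, ?_⟩
  · rw [norm_smul, norm_inv, Complex.norm_real, norm_norm]
    exact inv_mul_le_one
  · rcases eq_or_ne x 0 with rfl | hx
    · simp
    · rw [smul_inv_smul₀ (by simpa using hx)]

section ProjProduct

variable {X Y : Type*} [NormedAddCommGroup X] [NormedSpace ℂ X] [NormedAddCommGroup Y]
  [NormedSpace ℂ Y]

theorem norm_toProjProduct (w : X ⊗[ℂ] Y) : ‖toProjProduct w‖ = projNorm w :=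
  Completion.norm_coe (E := ProjTensor X Y) _

variable (X Y) in
/-- `toProjProduct` as a linear map. -/
noncomputable def toProjProductₗ : X ⊗[ℂ] Y →ₗ[ℂ] ProjProduct X Y where
  toFun := toProjProduct
  map_add' := toProjProduct_add
  map_smul' := toProjProduct_smul

end ProjProduct

variable {C X Y : Type*} [CommCStarAlgebra C]
  [NormedAddCommGroup X] [NormedSpace ℂ X]
  [Module C X] [Module Cᵐᵒᵖ X] [IsCentralScalar C X] [IsScalarTower ℂ C X]
  [NormedAddCommGroup Y] [NormedSpace ℂ Y] [Module C Y] [IsScalarTower ℂ C Y]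

theorem span_balancedRelations_le_map_ker :
    Submodule.span ℂ (balancedRelations C X Y) ≤
      (LinearMap.ker (TensorProduct.mapOfCompatibleSMul C ℂ ℂ X Y)).map (toProjProductₗ X Y) := by
  refine Submodule.span_le.2 ?_
  rintro _ ⟨x, c, y, rfl⟩
  refine ⟨_, LinearMap.mem_ker.2 ?_, rfl⟩
  rw [map_sub, TensorProduct.mapOfCompatibleSMul_tmul, TensorProduct.mapOfCompatibleSMul_tmul,
    op_smul_eq_smul, TensorProduct.smul_tmul, sub_self]

variable [IsBoundedSMul C X]

theorem norm_toBanachModuleTensor_tmul_le (x : X) (y : Y) :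
    ‖toBanachModuleTensor (x ⊗ₜ[C] y)‖ ≤ ‖x‖ * ‖y‖ := by
  rw [toBanachModuleTensor_tmul]
  refine (Submodule.Quotient.norm_mk_le _ _).trans ?_
  rw [norm_toProjProduct]
  simpa using projNorm_le (n := 1) (x := fun _ => x) (y := fun _ => y) (by simp)

theorem toBanachModuleTensor_smul (c : C) (w : X ⊗[C] Y) :
    toBanachModuleTensor (c • w) = c • toBanachModuleTensor w := by
  induction w using TensorProduct.induction_on with
  | zero => simp
  | tmul x y =>
    rw [TensorProduct.smul_tmul', toBanachModuleTensor_tmul, toBanachModuleTensor_tmul, ← map_smul,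
      ← toProjProduct_smul, TensorProduct.smul_tmul']
  | add w₁ w₂ h₁ h₂ => rw [smul_add, map_add, map_add, smul_add, h₁, h₂]

variable (C X Y) in
/-- `toBanachModuleTensor` as a linear map. -/
noncomputable def toBanachModuleTensorₗ : X ⊗[C] Y →ₗ[C] BanachModuleTensor C X Y where
  toFun := toBanachModuleTensor
  map_add' := map_add _
  map_smul' := toBanachModuleTensor_smul

theorem toBanachModuleTensor_mapOfCompatibleSMul (v : X ⊗[ℂ] Y) :
    toBanachModuleTensor (TensorProduct.mapOfCompatibleSMul C ℂ ℂ X Y v) =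
      (balancedSubmodule C X Y).mkQ (toProjProduct v) := by
  induction v using TensorProduct.induction_on with
  | zero => exact (map_zero _).trans (map_zero _).symm
  | tmul x y => rfl
  | add v₁ v₂ h₁ h₂ => rw [map_add, map_add, h₁, h₂, toProjProduct_add, map_add]

theorem denseRange_toBanachModuleTensorₗ : DenseRange (toBanachModuleTensorₗ C X Y) := by
  have hmk : DenseRange ((balancedSubmodule C X Y).mkQ ∘ toProjProductₗ X Y) :=
    (Submodule.mkQ_surjective _).denseRange.comp Completion.denseRange_coe
      (balancedSubmodule C X Y).mkQL.continuous
  refine hmk.mono ?_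
  rintro _ ⟨v, rfl⟩
  exact ⟨_, toBanachModuleTensor_mapOfCompatibleSMul v⟩

/-- The quotient norm is the distance to the closure of the span of the relations, hence the
distance to that span, and the elements of the span vanish in `X ⊗[C] Y`. -/
theorem exists_eq_sum_tmul_of_norm_toBanachModuleTensor_lt {w : X ⊗[C] Y} {t : ℝ}
    (hw : ‖toBanachModuleTensor w‖ < t) :
    ∃ (n : ℕ) (x : Fin n → X) (y : Fin n → Y),
      w = ∑ j, x j ⊗ₜ[C] y j ∧ ∑ j, ‖x j‖ * ‖y j‖ < t := by
  obtain ⟨v, rfl⟩ := TensorProduct.mapOfCompatibleSMul_surjective C ℂ ℂ X Y w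
  have hdist : Metric.infDist (toProjProduct v)
      (Submodule.span ℂ (balancedRelations C X Y) : Set (ProjProduct X Y)) < t := by
    rw [← Metric.infDist_closure, ← coe_balancedSubmodule]
    rw [toBanachModuleTensor_mapOfCompatibleSMul] at hw
    exact (QuotientAddGroup.norm_mk (S := (balancedSubmodule C X Y).toAddSubgroup) _).symm.trans_lt
      hw
  obtain ⟨z, hz, hzt⟩ := (Metric.infDist_lt_iff ⟨0, zero_mem _⟩).1 hdist
  obtain ⟨v', hv', rfl⟩ := span_balancedRelations_le_map_ker hz
  rw [dist_eq_norm] at hzt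
  obtain ⟨n, x, y, hxy, hlt⟩ := exists_rep_of_projNorm_lt (w := v - v') (t := t) <| by
    rwa [← norm_toProjProduct, toProjProduct_sub]
  refine ⟨n, x, y, ?_, hlt⟩
  have := congrArg (TensorProduct.mapOfCompatibleSMul C ℂ ℂ X Y) hxy
  rw [map_sub, LinearMap.mem_ker.1 hv', sub_zero, map_sum] at this
  exact this

theorem exists_eq_sum_smul_tmul_of_norm_toBanachModuleTensor_lt {w : X ⊗[C] Y} {t : ℝ}
    (hw : ‖toBanachModuleTensor w‖ < t) :
    ∃ (n : ℕ) (r : Fin n → ℝ) (x : Fin n → X) (y : Fin n → Y),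
      (∀ j, 0 ≤ r j) ∧ (∀ j, ‖x j‖ ≤ 1) ∧ (∀ j, ‖y j‖ ≤ 1) ∧
      w = ∑ j, (r j : ℂ) • (x j ⊗ₜ[C] y j) ∧ ∑ j, r j < t := by
  obtain ⟨n, x, y, rfl, hlt⟩ := exists_eq_sum_tmul_of_norm_toBanachModuleTensor_lt hw
  choose x' hx' hxx' using fun j => exists_smul_norm_le_one_eq (x j)
  choose y' hy' hyy' using fun j => exists_smul_norm_le_one_eq (y j)
  refine ⟨n, fun j => ‖x j‖ * ‖y j‖, x', y', fun j => by positivity, hx', hy',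
    Finset.sum_congr rfl fun j _ => ?_, hlt⟩
  calc x j ⊗ₜ[C] y j = ((‖x j‖ : ℂ) • x' j) ⊗ₜ[C] ((‖y j‖ : ℂ) • y' j) := by rw [← hxx', ← hyy']
    _ = ((‖x j‖ * ‖y j‖ : ℝ) : ℂ) • (x' j ⊗ₜ[C] y' j) := by
      rw [TensorProduct.tmul_smul, ← TensorProduct.smul_tmul', smul_smul, mul_comm,
        Complex.ofReal_mul]

end BanachModuleTensor

section OrthogonalMaxNormTensor

theorem sqrt_mem_Icc {A : Type*} [CStarAlgebra A] [PartialOrder A] [StarOrderedRing A] {a : A}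
    (ha : a ∈ Set.Icc 0 1) : CFC.sqrt a ∈ Set.Icc 0 1 :=
  ⟨CFC.sqrt_nonneg a, CFC.sqrt_one (A := A) ▸ CFC.sqrt_le_sqrt a 1 ha.2⟩

theorem sqrt_mul_sqrt_eq_zero {C : Type*} [CommCStarAlgebra C] [PartialOrder C] [StarOrderedRing C]
    {a b : C} (ha : 0 ≤ a) (hb : 0 ≤ b) (hab : a * b = 0) : CFC.sqrt a * CFC.sqrt b = 0 := by
  have hsa {c : C} : star (CFC.sqrt c) = CFC.sqrt c :=
    (IsSelfAdjoint.of_nonneg (CFC.sqrt_nonneg c)).star_eq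
  rw [← CStarRing.star_mul_self_eq_zero_iff, star_mul, hsa, hsa, mul_comm (CFC.sqrt b),
    mul_mul_mul_comm, CFC.sqrt_mul_sqrt_self a, CFC.sqrt_mul_sqrt_self b, hab]

theorem sum_smul_mem_of_convex_of_zero_mem {E ι : Type*} [AddCommGroup E] [Module ℝ E]
    [Fintype ι] {K : Set E} (hK : Convex ℝ K) (h0 : (0 : E) ∈ K) {r : ι → ℝ} (hr : ∀ i, 0 ≤ r i)
    (hr1 : ∑ i, r i ≤ 1) {z : ι → E} (hz : ∀ i, z i ∈ K) : ∑ i, r i • z i ∈ K := by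
  have := hK.sum_mem (t := Finset.univ) (w := fun o : Option ι => o.elim (1 - ∑ i, r i) r)
    (z := fun o => o.elim 0 z) (by simpa [Option.forall] using ⟨hr1, hr⟩)
    (by simp [Fintype.sum_option]) (by simpa [Option.forall] using ⟨h0, hz⟩)
  simpa [Fintype.sum_option] using this

theorem norm_smul_add_smul_le_of_mem_closure_convexHull {R E : Type*}
    [SeminormedAddCommGroup E] [NormedSpace ℝ E] [DistribSMul R E] [SMulCommClass ℝ R E]
    [ContinuousConstSMul R E] {S : Set E} {a b : R} {t : ℝ}
    (hS : ∀ x ∈ S, ∀ y ∈ S, ‖a • x + b • y‖ ≤ t) {x y : E} (hx : x ∈ closure (convexHull ℝ S))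
    (hy : y ∈ closure (convexHull ℝ S)) : ‖a • x + b • y‖ ≤ t := by
  let T : Set (E × E) := {p | ‖a • p.1 + b • p.2‖ ≤ t}
  have hlin : IsLinearMap ℝ fun p : E × E => a • p.1 + b • p.2 :=
    ⟨fun p q => by simp only [Prod.fst_add, Prod.snd_add, smul_add, add_add_add_comm],
      fun r p => by simp only [Prod.smul_fst, Prod.smul_snd, smul_add, smul_comm r]⟩
  have hconvex : Convex ℝ T := by
    simpa [T, Set.preimage] using (convex_closedBall (0 : E) t).is_linear_preimage hlin
  have hclosed : IsClosed T := isClosed_le (by fun_prop) continuous_const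
  have hsub : closure (convexHull ℝ (S ×ˢ S)) ⊆ T :=
    closure_minimal (convexHull_min (fun p hp => hS _ hp.1 _ hp.2) hconvex) hclosed
  rw [convexHull_prod, closure_prod_eq] at hsub
  exact hsub (Set.mk_mem_prod hx hy)

section CommCStarAlgebra

variable {C X Y : Type*} [CommCStarAlgebra C] [PartialOrder C] [StarOrderedRing C]
  [AddCommGroup X] [Module C X] [AddCommGroup Y] [Module C Y]

theorem sqrt_smul_add_tmul_sqrt_smul_add {a b : C} (ha : 0 ≤ a) (hb : 0 ≤ b) (hab : a * b = 0)
    (x x' : X) (y y' : Y) :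
    (CFC.sqrt a • x + CFC.sqrt b • x') ⊗ₜ[C] (CFC.sqrt a • y + CFC.sqrt b • y') =
      a • (x ⊗ₜ[C] y) + b • (x' ⊗ₜ[C] y') := by
  simp only [TensorProduct.add_tmul, TensorProduct.tmul_add, TensorProduct.tmul_smul,
    ← TensorProduct.smul_tmul', smul_add, smul_smul, mul_comm (CFC.sqrt b) (CFC.sqrt a),
    sqrt_mul_sqrt_eq_zero ha hb hab, zero_smul, add_zero, zero_add,
    CFC.sqrt_mul_sqrt_self a ha, CFC.sqrt_mul_sqrt_self b hb]

end CommCStarAlgebra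

variable {C X Y : Type*} [CommCStarAlgebra C]
  [NormedAddCommGroup X] [NormedSpace ℂ X]
  [Module C X] [Module Cᵐᵒᵖ X] [IsCentralScalar C X] [IsScalarTower ℂ C X] [IsBoundedSMul C X]
  [NormedAddCommGroup Y] [NormedSpace ℂ Y] [Module C Y] [IsScalarTower ℂ C Y]

theorem toBanachModuleTensor_smul_tmul {t : ℝ} (r : ℝ) (ht : t ≠ 0) (x : X) (y : Y) :
    toBanachModuleTensor ((r : ℂ) • (x ⊗ₜ[C] y)) =
      (r / t) • toBanachModuleTensor (((t : ℂ) • x) ⊗ₜ[C] y) := by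
  have h := ((toBanachModuleTensorₗ C X Y).restrictScalars ℂ).map_smul ((r / t : ℝ) : ℂ)
    (((t : ℂ) • x) ⊗ₜ[C] y)
  rw [TensorProduct.smul_tmul', smul_smul, ← Complex.ofReal_mul, div_mul_cancel₀ _ ht] at h
  exact h

theorem ball_subset_closure_convexHull_tmul {t : ℝ} (ht : 0 < t) :
    Metric.ball (0 : BanachModuleTensor C X Y) t ⊆ closure (convexHull ℝ
      {z | ∃ (x : X) (y : Y), ‖x‖ ≤ t ∧ ‖y‖ ≤ 1 ∧ toBanachModuleTensor (x ⊗ₜ[C] y) = z}) := by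
  refine (denseRange_toBanachModuleTensorₗ.open_subset_closure_inter Metric.isOpen_ball).trans
    (closure_mono ?_)
  rintro _ ⟨hw, w, rfl⟩
  obtain ⟨n, r, x, y, hr, hx, hy, rfl, hlt⟩ :=
    exists_eq_sum_smul_tmul_of_norm_toBanachModuleTensor_lt (mem_ball_zero_iff.1 hw)
  set S : Set (BanachModuleTensor C X Y) :=
    {z | ∃ (x : X) (y : Y), ‖x‖ ≤ t ∧ ‖y‖ ≤ 1 ∧ toBanachModuleTensor (x ⊗ₜ[C] y) = z}
  have hzero : (0 : BanachModuleTensor C X Y) ∈ S := ⟨0, 0, by simp [ht.le], by simp, by simp⟩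
  have hmem (j) : toBanachModuleTensor (((t : ℂ) • x j) ⊗ₜ[C] y j) ∈ S := by
    refine ⟨_, _, ?_, hy j, rfl⟩
    rw [norm_smul, Complex.norm_real, Real.norm_of_nonneg ht.le]
    exact mul_le_of_le_one_right ht.le (hx j)
  change toBanachModuleTensor _ ∈ _
  rw [map_sum]
  simp only [toBanachModuleTensor_smul_tmul _ ht.ne']
  refine sum_smul_mem_of_convex_of_zero_mem (convex_convexHull ℝ S) (subset_convexHull ℝ S hzero)
    (fun j => div_nonneg (hr j) ht.le) ?_ fun j => subset_convexHull ℝ S (hmem j)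
  rw [← Finset.sum_div, div_le_one ht]
  exact hlt.le

variable [PartialOrder C] [StarOrderedRing C]

theorem norm_smul_tmul_add_smul_tmul_le (hX : HasOrthogonalMaxNorm C X)
    (hY : HasOrthogonalMaxNorm C Y) {a b : C} (ha : a ∈ Set.Icc 0 1) (hb : b ∈ Set.Icc 0 1)
    (hab : a * b = 0) (x x' : X) (y y' : Y) :
    ‖a • toBanachModuleTensor (x ⊗ₜ[C] y) + b • toBanachModuleTensor (x' ⊗ₜ[C] y')‖ ≤
      max ‖x‖ ‖x'‖ * max ‖y‖ ‖y'‖ := by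
  have hsqrt := sqrt_mul_sqrt_eq_zero ha.1 hb.1 hab
  have hmap : toBanachModuleTensor
      ((CFC.sqrt a • x + CFC.sqrt b • x') ⊗ₜ[C] (CFC.sqrt a • y + CFC.sqrt b • y')) =
      a • toBanachModuleTensor (x ⊗ₜ[C] y) + b • toBanachModuleTensor (x' ⊗ₜ[C] y') := by
    rw [sqrt_smul_add_tmul_sqrt_smul_add ha.1 hb.1 hab, map_add, toBanachModuleTensor_smul,
      toBanachModuleTensor_smul]
  calc _ = ‖toBanachModuleTensor
        ((CFC.sqrt a • x + CFC.sqrt b • x') ⊗ₜ[C] (CFC.sqrt a • y + CFC.sqrt b • y'))‖ := by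
        rw [hmap]
    _ ≤ ‖CFC.sqrt a • x + CFC.sqrt b • x'‖ * ‖CFC.sqrt a • y + CFC.sqrt b • y'‖ :=
        norm_toBanachModuleTensor_tmul_le _ _
    _ ≤ _ := mul_le_mul (hX (sqrt_mem_Icc ha) (sqrt_mem_Icc hb) hsqrt x x')
        (hY (sqrt_mem_Icc ha) (sqrt_mem_Icc hb) hsqrt y y') (norm_nonneg _)
        ((norm_nonneg _).trans (le_max_left _ _))

theorem HasOrthogonalMaxNorm.banachModuleTensor
    (hX : HasOrthogonalMaxNorm C X) (hY : HasOrthogonalMaxNorm C Y) :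
    HasOrthogonalMaxNorm C (BanachModuleTensor C X Y) := by
  intro a b ha hb hab p q
  refine le_of_forall_gt_imp_ge_of_dense fun t ht => ?_
  obtain ⟨hp, hq⟩ := max_lt_iff.1 ht
  have ht0 : 0 < t := (norm_nonneg p).trans_lt hp
  have hp' := ball_subset_closure_convexHull_tmul ht0 (mem_ball_zero_iff.2 hp)
  have hq' := ball_subset_closure_convexHull_tmul ht0 (mem_ball_zero_iff.2 hq)
  refine norm_smul_add_smul_le_of_mem_closure_convexHull (R := C) ?_ hp' hq'
  rintro _ ⟨x, y, hx, hy, rfl⟩ _ ⟨x', y', hx', hy', rfl⟩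
  refine (norm_smul_tmul_add_smul_tmul_le hX hY ha hb hab x x' y y').trans ?_
  calc max ‖x‖ ‖x'‖ * max ‖y‖ ‖y'‖ ≤ t * 1 :=
        mul_le_mul (max_le hx hx') (max_le hy hy') (le_max_of_le_left (norm_nonneg y)) ht0.le
    _ = t := mul_one t

end OrthogonalMaxNormTensor

section GammaNorm

section General

variable (A : Type*) {R : Type*} (D : Type*) {X Y : Type*}
  [CStarAlgebra A] [CommCStarAlgebra R] [CStarAlgebra D]
  [NormedAddCommGroup X] [NormedSpace ℂ X] [NormedAddCommGroup Y] [NormedSpace ℂ Y]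
  [Module R X] [Module R Y] [Module A X] [Module Dᵐᵒᵖ Y]
  [IsScalarTower ℂ R X] [IsScalarTower ℂ R Y] [IsScalarTower ℂ A X] [IsScalarTower ℂ Dᵐᵒᵖ Y]

theorem gammaNorm_tmul_le (x : X) (y : Y) : gammaNorm A D (x ⊗ₜ[R] y) ≤ ‖x‖ * ‖y‖ := by
  obtain ⟨x', hx', hxx'⟩ := exists_smul_norm_le_one_eq x
  obtain ⟨y', hy', hyy'⟩ := exists_smul_norm_le_one_eq y
  have hrep : GammaRep A D (x' ⊗ₜ[R] y') (n := 1) (fun _ => 1) (fun _ => 1) (fun _ => x')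
      (fun _ => y') := ⟨fun _ => hx', fun _ => hy', by simp⟩
  have hunit : gammaNorm A D (x' ⊗ₜ[R] y') ≤ 1 :=
    hrep.gammaNorm_le A D (by simpa using norm_one_le_one A) (by simpa using norm_one_le_one D)
  have heq : x ⊗ₜ[R] y = ((‖x‖ * ‖y‖ : ℝ) : ℂ) • (x' ⊗ₜ[R] y') := by
    rw [Complex.ofReal_mul, mul_comm, mul_smul, TensorProduct.smul_tmul', ← hxx',
      ← TensorProduct.tmul_smul, ← hyy']
  calc gammaNorm A D (x ⊗ₜ[R] y) ≤ ‖((‖x‖ * ‖y‖ : ℝ) : ℂ)‖ * gammaNorm A D (x' ⊗ₜ[R] y') :=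
        heq ▸ gammaNorm_smul_le A D _ _
    _ ≤ ‖x‖ * ‖y‖ := by
        rw [Complex.norm_real, Real.norm_of_nonneg (by positivity)]
        exact mul_le_of_le_one_right (by positivity) hunit

theorem gammaNorm_sum_tmul_le {ι : Type*} (s : Finset ι) (x : ι → X) (y : ι → Y) :
    gammaNorm A D (∑ j ∈ s, x j ⊗ₜ[R] y j) ≤ ∑ j ∈ s, ‖x j‖ * ‖y j‖ :=
  (Finset.le_sum_of_subadditive _ (gammaNorm_zero A D).le (gammaNorm_add_le A D) s _).trans
    (Finset.sum_le_sum fun j _ => gammaNorm_tmul_le A D (x j) (y j))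

theorem gammaNorm_le_norm_toBanachModuleTensor [Module Rᵐᵒᵖ X] [IsCentralScalar R X]
    [IsBoundedSMul R X] (w : X ⊗[R] Y) : gammaNorm A D w ≤ ‖toBanachModuleTensor w‖ := by
  refine le_of_forall_gt_imp_ge_of_dense fun t ht => ?_
  obtain ⟨n, x, y, rfl, hlt⟩ := exists_eq_sum_tmul_of_norm_toBanachModuleTensor_lt ht
  exact (gammaNorm_sum_tmul_le A D _ x y).trans hlt.le

variable {A D}

theorem gammaNorm_le_of_starAlgHom {A' D' : Type*} [CStarAlgebra A'] [CStarAlgebra D']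
    [Module A' X] [Module D'ᵐᵒᵖ Y] [IsScalarTower ℂ A' X] [IsScalarTower ℂ D'ᵐᵒᵖ Y]
    (φ : A →⋆ₐ[ℂ] A') (ψ : D →⋆ₐ[ℂ] D') (hφ : ∀ (a : A) (x : X), φ a • x = a • x)
    (hψ : ∀ (d : D) (y : Y), MulOpposite.op (ψ d) • y = MulOpposite.op d • y) (w : X ⊗[R] Y) :
    gammaNorm A' D' w ≤ gammaNorm A D w := by
  refine le_of_forall_gt_imp_ge_of_dense fun t ht => ?_
  obtain ⟨n, a, b, x, y, h, ha, hb⟩ := exists_gammaRep_of_lt A D ht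
  have hrep : GammaRep A' D' w (fun j => φ (a j)) (fun j => ψ (b j)) x y :=
    ⟨h.norm_left, h.norm_right, by simpa only [hφ, hψ] using h.eq_sum⟩
  refine hrep.gammaNorm_le A' D' ?_ ?_
  · simp only [← map_star, ← map_mul, ← map_sum]
    exact (NonUnitalStarAlgHom.norm_apply_le φ _).trans ha
  · simp only [← map_star, ← map_mul, ← map_sum]
    exact (NonUnitalStarAlgHom.norm_apply_le ψ _).trans hb

end General

variable {C X Y : Type*} [CommCStarAlgebra C]
  [NormedAddCommGroup X] [NormedSpace ℂ X]
  [Module C X] [Module Cᵐᵒᵖ X] [IsCentralScalar C X] [IsScalarTower ℂ C X] [IsBoundedSMul C X]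
  [NormedAddCommGroup Y] [NormedSpace ℂ Y] [Module C Y] [IsScalarTower ℂ C Y]

theorem norm_toBanachModuleTensor_tmul_le_one {x : X} {y : Y} (hx : ‖x‖ ≤ 1) (hy : ‖y‖ ≤ 1) :
    ‖toBanachModuleTensor (x ⊗ₜ[C] y)‖ ≤ 1 :=
  (norm_toBanachModuleTensor_tmul_le x y).trans (mul_le_one₀ hx (norm_nonneg y) hy)

theorem toBanachModuleTensor_sum_smul_tmul {ι : Type*} (s : Finset ι) (c : ι → C) (x : ι → X)
    (y : ι → Y) : toBanachModuleTensor (∑ j ∈ s, (c j • x j) ⊗ₜ[C] y j) =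
      ∑ j ∈ s, c j • toBanachModuleTensor (x j ⊗ₜ[C] y j) := by
  simp only [map_sum, ← TensorProduct.smul_tmul', toBanachModuleTensor_smul]

variable [PartialOrder C] [StarOrderedRing C]

theorem norm_toBanachModuleTensor_eq_sInf
    (h : HasOrthogonalMaxNorm C (BanachModuleTensor C X Y)) (w : X ⊗[C] Y) :
    ‖toBanachModuleTensor w‖ =
      sInf {r : ℝ | ∃ (n : ℕ) (c : Fin n → C) (x : Fin n → X) (y : Fin n → Y),
        (∀ j, 0 ≤ c j) ∧ (∀ j, ‖x j‖ ≤ 1) ∧ (∀ j, ‖y j‖ ≤ 1) ∧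
        w = ∑ j, (c j • x j) ⊗ₜ[C] y j ∧ r = ‖∑ j, c j‖} := by
  set S : Set ℝ := {r | ∃ (n : ℕ) (c : Fin n → C) (x : Fin n → X) (y : Fin n → Y),
    (∀ j, 0 ≤ c j) ∧ (∀ j, ‖x j‖ ≤ 1) ∧ (∀ j, ‖y j‖ ≤ 1) ∧
    w = ∑ j, (c j • x j) ⊗ₜ[C] y j ∧ r = ‖∑ j, c j‖}
  have hlower : ‖toBanachModuleTensor w‖ ∈ lowerBounds S := by
    rintro _ ⟨n, c, x, y, hc, hx, hy, rfl, rfl⟩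
    rw [toBanachModuleTensor_sum_smul_tmul]
    exact h.norm_sum_smul_le hc fun j => norm_toBanachModuleTensor_tmul_le_one (hx j) (hy j)
  have hexists (t : ℝ) (ht : ‖toBanachModuleTensor w‖ < t) : ∃ r ∈ S, r ≤ t := by
    obtain ⟨n, r, x, y, hr, hx, hy, hw, hlt⟩ :=
      exists_eq_sum_smul_tmul_of_norm_toBanachModuleTensor_lt ht
    refine ⟨_, ⟨n, fun j => algebraMap ℝ C (r j), x, y, fun j => algebraMap_nonneg C (hr j), hx,
      hy, ?_, rfl⟩, ?_⟩
    · simp only [IsScalarTower.algebraMap_apply ℝ ℂ C, algebraMap_smul]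
      exact hw
    · rw [← map_sum, norm_algebraMap, Real.norm_of_nonneg (Finset.sum_nonneg fun j _ => hr j)]
      exact (mul_le_of_le_one_right (Finset.sum_nonneg fun j _ => hr j)
        (norm_one_le_one C)).trans hlt.le
  obtain ⟨r, hr, -⟩ := hexists _ (lt_add_one _)
  refine le_antisymm (le_csInf ⟨r, hr⟩ hlower) (le_of_forall_gt_imp_ge_of_dense fun t ht => ?_)
  obtain ⟨r, hr, hrt⟩ := hexists t ht
  exact (csInf_le ⟨_, hlower⟩ hr).trans hrt

variable [Module Cᵐᵒᵖ Y] [IsCentralScalar C Y]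

theorem norm_toBanachModuleTensor_le_gammaNorm
    (h : HasOrthogonalMaxNorm C (BanachModuleTensor C X Y)) (w : X ⊗[C] Y) :
    ‖toBanachModuleTensor w‖ ≤ gammaNorm C C w := by
  refine le_of_forall_gt_imp_ge_of_dense fun t ht => ?_
  obtain ⟨n, a, b, x, y, hrep, ha, hb⟩ := exists_gammaRep_of_lt C C ht
  have hw : w = ∑ j, ((a j * b j) • x j) ⊗ₜ[C] y j := by
    simp only [hrep.eq_sum, op_smul_eq_smul, TensorProduct.smul_tmul, mul_comm (a _), mul_smul]
  have hmean (j : Fin n) : 0 ≤ (2⁻¹ : ℝ) • (a j * star (a j) + star (b j) * b j) :=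
    smul_nonneg (by norm_num) (add_nonneg (mul_star_self_nonneg _) (star_mul_self_nonneg _))
  calc ‖toBanachModuleTensor w‖
      = ‖∑ j, (a j * b j) • toBanachModuleTensor (x j ⊗ₜ[C] y j)‖ := by
        rw [hw, toBanachModuleTensor_sum_smul_tmul]
    _ ≤ ‖∑ j, (2⁻¹ : ℝ) • (a j * star (a j) + star (b j) * b j)‖ :=
        h.norm_sum_smul_le_of_star_mul_self_le hmean (fun j => star_mul_mul_le_sq (a j) (b j))
          fun j => norm_toBanachModuleTensor_tmul_le_one (hrep.norm_left j) (hrep.norm_right j)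
    _ = 2⁻¹ * ‖∑ j, a j * star (a j) + ∑ j, star (b j) * b j‖ := by
        rw [← Finset.smul_sum, Finset.sum_add_distrib, norm_smul, Real.norm_of_nonneg (by norm_num)]
    _ ≤ 2⁻¹ * (t + t) := by gcongr; exact norm_add_le_of_le ha hb
    _ = t := by ring

theorem gammaNorm_self_eq_norm_toBanachModuleTensor
    (h : HasOrthogonalMaxNorm C (BanachModuleTensor C X Y)) (w : X ⊗[C] Y) :
    gammaNorm C C w = ‖toBanachModuleTensor w‖ :=
  le_antisymm (gammaNorm_le_norm_toBanachModuleTensor C C w)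
    (norm_toBanachModuleTensor_le_gammaNorm h w)

theorem gammaNorm_complex_eq_norm_toBanachModuleTensor [Module ℂᵐᵒᵖ Y] [IsCentralScalar ℂ Y]
    (h : HasOrthogonalMaxNorm C (BanachModuleTensor C X Y)) (w : X ⊗[C] Y) :
    gammaNorm ℂ ℂ w = ‖toBanachModuleTensor w‖ := by
  refine le_antisymm (gammaNorm_le_norm_toBanachModuleTensor ℂ ℂ w)
    ((norm_toBanachModuleTensor_le_gammaNorm h w).trans ?_)
  refine gammaNorm_le_of_starAlgHom (StarAlgHom.ofId ℂ C) (StarAlgHom.ofId ℂ C)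
    (fun l x => ?_) (fun l y => ?_) w
  · exact algebraMap_smul C l x
  · rw [op_smul_eq_smul, op_smul_eq_smul]
    exact algebraMap_smul C l y

end GammaNorm

section Isometries

theorem exists_linearIsometryEquiv_of_norm_eq {𝕜 R E F G : Type*} [NormedField 𝕜] [Semiring R]
    [SMul 𝕜 R] [AddCommGroup E] [Module 𝕜 E] [Module R E] [IsScalarTower 𝕜 R E]
    [NormedAddCommGroup F] [NormedSpace 𝕜 F] [CompleteSpace F] [Module R F]
    [IsScalarTower 𝕜 R F] [ContinuousConstSMul R F]
    [NormedAddCommGroup G] [NormedSpace 𝕜 G] [CompleteSpace G] [Module R G]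
    [IsScalarTower 𝕜 R G] [ContinuousConstSMul R G]
    (i : E →ₗ[R] F) (j : E →ₗ[R] G) (hi : DenseRange i) (hj : DenseRange j)
    (hnorm : ∀ v, ‖j v‖ = ‖i v‖) :
    ∃ e : F ≃ₗᵢ[𝕜] G, (∀ (r : R) (z : F), e (r • z) = r • e z) ∧ ∀ v, e (i v) = j v := by
  set e : F ≃ₗᵢ[𝕜] G := (LinearEquiv.refl 𝕜 E).extendOfIsometry (i.restrictScalars 𝕜)
    (j.restrictScalars 𝕜) hi hj hnorm
  have he (v : E) : e (i v) = j v := 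
    LinearEquiv.extendOfIsometry_eq _ (i.restrictScalars 𝕜) (j.restrictScalars 𝕜) hi hj hnorm v
  refine ⟨e, fun r => hi.induction ?_ (isClosed_eq ?_ ?_), he⟩
  · rintro _ ⟨v, rfl⟩
    rw [← map_smul, he, he, map_smul]
  · exact e.continuous.comp (continuous_const_smul r)
  · exact e.continuous.const_smul r

variable (A D : Type*) {C X Y : Type*} [CommCStarAlgebra C] [CStarAlgebra A] [CStarAlgebra D]
  [NormedAddCommGroup X] [NormedSpace ℂ X] [Module C X] [Module A X]
  [IsScalarTower ℂ C X] [IsBoundedSMul C X] [IsScalarTower ℂ A X] [SMulCommClass C A X]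
  [NormedAddCommGroup Y] [NormedSpace ℂ Y] [Module C Y] [Module Dᵐᵒᵖ Y]
  [IsScalarTower ℂ C Y] [IsScalarTower ℂ Dᵐᵒᵖ Y]

instance : IsScalarTower ℂ C (GammaTensor A C D X Y) :=
  inferInstanceAs (IsScalarTower ℂ C (X ⊗[C] Y))

variable (C X Y) in
/-- `toGammaProduct` as a linear map. -/
noncomputable def toGammaProductₗ : X ⊗[C] Y →ₗ[C] GammaProduct A C D X Y where
  toFun := toGammaProduct A D
  map_add' := Completion.coe_add (α := GammaTensor A C D X Y)
  map_smul' c w := Completion.coe_smul (X := GammaTensor A C D X Y) c w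

theorem denseRange_toGammaProductₗ : DenseRange (toGammaProductₗ A D C X Y) :=
  Completion.denseRange_coe (α := GammaTensor A C D X Y)

end Isometries

theorem mainTheorem5_general {C X Y : Type*} [CommCStarAlgebra C] [PartialOrder C]
    [StarOrderedRing C] [NormedAddCommGroup X] [NormedSpace ℂ X]
    [Module C X] [Module Cᵐᵒᵖ X] [IsCentralScalar C X] [IsScalarTower ℂ C X] [IsBoundedSMul C X]
    [NormedAddCommGroup Y] [NormedSpace ℂ Y]
    [Module C Y] [Module Cᵐᵒᵖ Y] [IsCentralScalar C Y] [IsScalarTower ℂ C Y]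
    [Module ℂᵐᵒᵖ Y] [IsCentralScalar ℂ Y]
    (hX : HasOrthogonalMaxNorm C X) (hY : HasOrthogonalMaxNorm C Y) :
    (∀ w : X ⊗[C] Y,
      ‖toBanachModuleTensor w‖ =
        sInf {r : ℝ | ∃ (n : ℕ) (c : Fin n → C) (x : Fin n → X) (y : Fin n → Y),
          (∀ j, 0 ≤ c j) ∧ (∀ j, ‖x j‖ ≤ 1) ∧ (∀ j, ‖y j‖ ≤ 1) ∧
          w = ∑ j, (c j • x j) ⊗ₜ[C] y j ∧ r = ‖∑ j, c j‖}) ∧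
    (∀ w : X ⊗[C] Y,
      gammaNorm ℂ ℂ w = ‖toBanachModuleTensor w‖ ∧ gammaNorm C C w = ‖toBanachModuleTensor w‖) ∧
    (∃ e : GammaProduct ℂ C ℂ X Y ≃ₗᵢ[ℂ] GammaProduct C C C X Y,
      (∀ (c : C) (z : GammaProduct ℂ C ℂ X Y), e (c • z) = c • e z) ∧
      ∀ w : X ⊗[C] Y, e (toGammaProduct ℂ ℂ w) = toGammaProduct C C w) ∧
    (∃ e : GammaProduct C C C X Y ≃ₗᵢ[ℂ] BanachModuleTensor C X Y,
      (∀ (c : C) (z : GammaProduct C C C X Y), e (c • z) = c • e z) ∧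
      ∀ w : X ⊗[C] Y, e (toGammaProduct C C w) = toBanachModuleTensor w) := by
  have h := hX.banachModuleTensor hY
  have hℂ := gammaNorm_complex_eq_norm_toBanachModuleTensor h
  have hC := gammaNorm_self_eq_norm_toBanachModuleTensor h
  refine ⟨norm_toBanachModuleTensor_eq_sInf h, fun w => ⟨hℂ w, hC w⟩, ?_, ?_⟩
  · refine exists_linearIsometryEquiv_of_norm_eq (toGammaProductₗ ℂ ℂ C X Y)
      (toGammaProductₗ C C C X Y) (denseRange_toGammaProductₗ ℂ ℂ) (denseRange_toGammaProductₗ C C)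
      fun w => ?_
    exact (norm_toGammaProduct C C w).trans
      (((hC w).trans (hℂ w).symm).trans (norm_toGammaProduct ℂ ℂ w).symm)
  · exact exists_linearIsometryEquiv_of_norm_eq (toGammaProductₗ C C C X Y)
      (toBanachModuleTensorₗ C X Y) (denseRange_toGammaProductₗ C C)
      denseRange_toBanachModuleTensorₗ
      fun w => (hC w).symm.trans (norm_toGammaProduct C C w).symm

theorem mainTheorem5 {C X Y : Type*}
    -- a unital commutative C*-algebra with its usual order
    [CommCStarAlgebra C] [PartialOrder C] [StarOrderedRing C]
    -- `X` and `Y` are central Banach `C`-bimodules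
    [NormedAddCommGroup X] [NormedSpace ℂ X] [CompleteSpace X]
    [Module C X] [Module Cᵐᵒᵖ X] [IsCentralScalar C X] [IsScalarTower ℂ C X] [IsBoundedSMul C X]
    [NormedAddCommGroup Y] [NormedSpace ℂ Y] [CompleteSpace Y]
    [Module C Y] [Module Cᵐᵒᵖ Y] [IsCentralScalar C Y] [IsScalarTower ℂ C Y] [IsBoundedSMul C Y]
    -- complex scalars may be written on either side of elements of `Y`
    [Module ℂᵐᵒᵖ Y] [IsCentralScalar ℂ Y]
    (hX : IsRepresentable C C X) (hY : IsRepresentable C C Y) :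
    (∀ w : X ⊗[C] Y,
      ‖toBanachModuleTensor w‖ =
        sInf {r : ℝ | ∃ (n : ℕ) (c : Fin n → C) (x : Fin n → X) (y : Fin n → Y),
          (∀ j, 0 ≤ c j) ∧ (∀ j, ‖x j‖ ≤ 1) ∧ (∀ j, ‖y j‖ ≤ 1) ∧
          w = ∑ j, (c j • x j) ⊗ₜ[C] y j ∧ r = ‖∑ j, c j‖}) ∧
    (∀ w : X ⊗[C] Y,
      gammaNorm ℂ ℂ w = ‖toBanachModuleTensor w‖ ∧ gammaNorm C C w = ‖toBanachModuleTensor w‖) ∧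
    (∃ e : GammaProduct ℂ C ℂ X Y ≃ₗᵢ[ℂ] GammaProduct C C C X Y,
      (∀ (c : C) (z : GammaProduct ℂ C ℂ X Y), e (c • z) = c • e z) ∧
      ∀ w : X ⊗[C] Y, e (toGammaProduct ℂ ℂ w) = toGammaProduct C C w) ∧
    (∃ e : GammaProduct C C C X Y ≃ₗᵢ[ℂ] BanachModuleTensor C X Y,
      (∀ (c : C) (z : GammaProduct C C C X Y), e (c • z) = c • e z) ∧
      ∀ w : X ⊗[C] Y, e (toGammaProduct C C w) = toBanachModuleTensor w) :=
  mainTheorem5_general hX.hasOrthogonalMaxNorm hY.hasOrthogonalMaxNorm
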